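/- Let $d\ge 1$, let $x_1,x_2,\dots$ be the points of a homogeneous Poisson process on $(0,\infty)^d$ of intensity $\lambda\in(0,\infty)$, and let $\rho,\rho_1,\rho_2,\dots$ be i.i.d. random variables with values in $(0,\infty)$, with $(\rho_i)_{i\ge1}$ independent of $(x_i)_{i\ge1}$. Let $$D:=\{z\in(0,\infty)^d:\ \text{there exist distinct } x_i \text{ and } x_j \text{ with } z\in(x_i+[0,\rho_i]^d)\cap(x_j+[0,\rho_j]^d)\},$$ and say that $\mathbb R_+^d=[0,\infty)^d$ is eventually doubly covered if there is $\mathbf t\in\mathbb R_+^d$ with $\mathbf t+\mathbb R_+^d\subseteq D$. Put $$l:=\liminf_{x\to\infty}x\,\mathbb P(\rho>x)\in[0,\infty],\qquad L:=\limsup_{x\to\infty}x\,\mathbb P(\rho>x)\in[0,\infty].$$ (i) Let $d=1$ and suppose $0<l\le L<\infty$. Then there is a number $\lambda_0$ with $1/L\le\lambda_0\le 1/l$, depending only on the distribution of $\rho$, such that for every intensity $\lambda>0$ $$\mathbb P(\mathbb R_+\text{ is eventually doubly covered})=\begin{cases}0&\text{if }\lambda<\lambda_0,\\ 1&\text{if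 }\lambda>\lambda_0.\end{cases}$$ (ii) Let $d\ge2$. Then for every intensity $\lambda>0$ $$\mathbb P(\mathbb R_+^d\text{ is eventually doubly covered})=\begin{cases}0&\text{if }L=0,\\ 1&\text{if }l>0.\end{cases}$$ -/

import Mathlib

open MeasureTheory ProbabilityTheory Filter Set
open scoped NNReal ENNReal

noncomputable section

namespace PoissonBoolean

/-- The open orthant `(0, ∞)^d`, in which the Poisson points and the covered region live. -/
def openOrthant (d : ℕ) : Set (Fin d → ℝ) := {z | ∀ k, 0 < z k}

/-- The number (possibly infinite) of points of the sequence `x 0, x 1, …` that fall in `B`. -/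
def pointCount {Ω : Type*} {d : ℕ} (x : ℕ → Ω → (Fin d → ℝ)) (B : Set (Fin d → ℝ)) (ω : Ω) : ℕ∞ :=
  {n : ℕ | x n ω ∈ B}.encard

/-- The random points `x 0, x 1, …` form a homogeneous Poisson point process on `(0, ∞)^d` of
intensity `lam`: the number of points in a Borel set of finite Lebesgue measure `v` has the
Poisson distribution with mean `lam * v`, and the numbers of points in finitely many pairwise
disjoint Borel sets are independent. -/
structure IsPoissonProcess {Ω : Type*} [MeasurableSpace Ω] (P : Measure Ω) (d : ℕ) (lam : ℝ≥0)
    (x : ℕ → Ω → (Fin d → ℝ)) : Prop where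
  measurable : ∀ n, Measurable (x n)
  mem_openOrthant : ∀ n, ∀ᵐ ω ∂P, x n ω ∈ openOrthant d
  hasLaw_pointCount : ∀ B : Set (Fin d → ℝ), MeasurableSet B → B ⊆ openOrthant d →
    volume B < ∞ →
      HasLaw (pointCount x B)
        ((poissonMeasure (lam * (volume B).toNNReal)).map ((↑) : ℕ → ℕ∞)) P
  iIndepFun_pointCount : ∀ (m : ℕ) (B : Fin m → Set (Fin d → ℝ)),
    (∀ i, MeasurableSet (B i)) → (∀ i, B i ⊆ openOrthant d) →
      Pairwise (fun i j => Disjoint (B i) (B j)) →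
        iIndepFun (fun i => pointCount x (B i)) P

/-- The Poisson Boolean model on `ℝ₊^d`: a Poisson process `x` on `(0, ∞)^d` of intensity `lam`,
and, independent of it, i.i.d. random variables `ρ 0, ρ 1, …` with common law `ν`. -/
structure IsModel {Ω : Type*} [MeasurableSpace Ω] (P : Measure Ω) (d : ℕ) (lam : ℝ≥0)
    (ν : Measure ℝ) (x : ℕ → Ω → (Fin d → ℝ)) (ρ : ℕ → Ω → ℝ) : Prop where
  isPoissonProcess : IsPoissonProcess P d lam x
  measurable_side : ∀ n, Measurable (ρ n)
  hasLaw_side : ∀ n, HasLaw (ρ n) ν P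
  iIndepFun_side : iIndepFun ρ P
  indepFun : IndepFun (fun ω n => x n ω) (fun ω n => ρ n ω) P

/-- The cube `a + [0, r]^d`. -/
def cube {d : ℕ} (a : Fin d → ℝ) (r : ℝ) : Set (Fin d → ℝ) :=
  {z | ∀ k, a k ≤ z k ∧ z k ≤ a k + r}

/-- The doubly covered region for a configuration of points `a i` and side lengths `r i`: the
points of `(0, ∞)^d` lying in the cubes of two distinct points of the configuration. -/
def doublyCovered {d : ℕ} (a : ℕ → (Fin d → ℝ)) (r : ℕ → ℝ) : Set (Fin d → ℝ) :=
  {z | z ∈ openOrthant d ∧ ∃ i j, a i ≠ a j ∧ z ∈ cube (a i) (r i) ∩ cube (a j) (r j)}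

/-- `ℝ₊^d` is eventually doubly covered: some translate `t + ℝ₊^d`, with `t ∈ ℝ₊^d`, is contained
in the doubly covered region. -/
def EventuallyDoublyCovered {d : ℕ} (a : ℕ → (Fin d → ℝ)) (r : ℕ → ℝ) : Prop :=
  ∃ t : Fin d → ℝ, (∀ k, 0 ≤ t k) ∧ ∀ y : Fin d → ℝ, (∀ k, 0 ≤ y k) → t + y ∈ doublyCovered a r

/-- `liminf_{x → ∞} x P(ρ > x)`, as an element of `[0, ∞]`, for `ρ` with law `ν`. -/
def lowerTail (ν : Measure ℝ) : ℝ≥0∞ :=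
  liminf (fun s : ℝ => ENNReal.ofReal s * ν (Ioi s)) atTop

/-- `limsup_{x → ∞} x P(ρ > x)`, as an element of `[0, ∞]`, for `ρ` with law `ν`. -/
def upperTail (ν : Measure ℝ) : ℝ≥0∞ :=
  limsup (fun s : ℝ => ENNReal.ofReal s * ν (Ioi s)) atTop

end PoissonBoolean

end

/-! Everything reduces to the series `∑ exp (-(θ * tailSum ν n))`, where `θ = lam * T ^ (d - 1)` is
the effective intensity of a strip of width `T` along one axis.

If the series diverges for every integer `T`, coverage fails. Rounding points to unit cells makes
the events `unreached` regenerative with probabilities comparable to the terms, so by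
`ae_frequently_of_renewal` they recur almost surely. Each unreached level yields a point in no cube
at all, so even single coverage fails.

If the series converges for some `θ` with `θ * d < lam * T ^ (d - 1)`, double coverage holds. Unit
cells are cut into `K` subcell classes. If deleting any single class still leaves a covering point,
then two distinct points cover. Deleting a class costs only a factor `1 - 1 / K` in the exponent,
absorbed by the strict inequality, and Borel–Cantelli over lattice cubes concludes. Needing two
points instead of one therefore does not move the threshold.

For `d = 1` the width is irrelevant and the threshold is the infimum of the `θ` giving convergence;
comparison with harmonic sums places it between `1 / L` and `1 / l`. For `d ≥ 2`, `T ^ (d - 1)`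
makes the effective intensity arbitrarily large, so `l > 0` suffices; if `L = 0`, every finite
intensity is subcritical. -/

namespace PoissonBoolean

/-! ### Void probabilities of the marked process. -/

/-- The probability generating function of the Poisson distribution. -/
theorem lintegral_pow_poissonMeasure (r : ℝ≥0) {p : ℝ} (hp : 0 ≤ p) :
    ∫⁻ n, ENNReal.ofReal p ^ n ∂(poissonMeasure r) = ENNReal.ofReal (Real.exp (-(r * (1 - p)))) := by
  have key : HasSum (fun n : ℕ => Real.exp (-r) * (r : ℝ) ^ n / (n.factorial : ℝ) * p ^ n)
      (Real.exp (-(r * (1 - p)))) := by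
    have h := (NormedSpace.expSeries_div_hasSum_exp ((r : ℝ) * p)).mul_left (Real.exp (-r))
    rw [← Real.exp_eq_exp_ℝ, ← Real.exp_add] at h
    convert! h using 1
    · funext n; rw [mul_pow]; ring
    · congr 1; ring
  rw [poissonMeasure, lintegral_sum_measure]
  simp_rw [lintegral_smul_measure, lintegral_dirac, smul_eq_mul]
  rw [← key.tsum_eq, ENNReal.ofReal_tsum_of_nonneg (fun n => by positivity) key.summable]
  congr 1
  funext n
  rw [ENNReal.ofReal_mul (by positivity), ENNReal.ofReal_pow hp]

/-- With the points frozen, only finitely many marks are constrained, and disjointness of the `B i`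
leaves each with a single forbidden set; independence then gives a product. -/
theorem measure_forall_notMem_of_finite {Ω X ι : Type*} [MeasurableSpace Ω] [Fintype ι]
    {P : Measure Ω} {ν : Measure ℝ} {ρ : ℕ → Ω → ℝ}
    (hlaw : ∀ n, HasLaw (ρ n) ν P) (hind : iIndepFun ρ P)
    {B : ι → Set X} (hdisj : Pairwise fun i j => Disjoint (B i) (B j))
    {R : ι → Set ℝ} (hR : ∀ i, MeasurableSet (R i)) (y : ℕ → X)
    (hfin : ∀ i, {n | y n ∈ B i}.Finite) :
    P {ω | ∀ n i, y n ∈ B i → ρ n ω ∉ R i} =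
      ∏ i, ν (R i)ᶜ ^ ({n | y n ∈ B i}.encard).toNat := by
  classical
  set s : Finset ℕ := Finset.univ.biUnion fun i => (hfin i).toFinset with hs
  set G : ℕ → Set ℝ := fun n => ⋂ i, ⋂ (_ : y n ∈ B i), (R i)ᶜ with hG
  have hGm : ∀ n, MeasurableSet (G n) := fun n =>
    MeasurableSet.iInter fun i => MeasurableSet.iInter fun _ => (hR i).compl
  have hGeq : ∀ n i, y n ∈ B i → G n = (R i)ᶜ := by
    intro n i hi
    ext r
    simp only [hG, mem_iInter, mem_compl_iff]
    refine ⟨fun h => h i hi, fun h j hj => ?_⟩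
    have : j = i := by
      by_contra hne
      exact Set.disjoint_left.1 (hdisj hne) hj hi
    exact this ▸ h
  have hev : {ω | ∀ n i, y n ∈ B i → ρ n ω ∉ R i} = ⋂ n ∈ s, ρ n ⁻¹' G n := by
    ext ω
    simp only [hs, hG, mem_ofPred_eq, Finset.mem_biUnion, Finset.mem_univ, true_and,
      Finite.mem_toFinset, mem_iInter, mem_preimage, mem_compl_iff]
    exact ⟨fun h n _ i hi => h n i hi, fun h n i hi => h n ⟨i, hi⟩ i hi⟩
  rw [hev, hind.measure_inter_preimage_eq_mul s (fun n _ => hGm n), hs, Finset.prod_biUnion]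
  · refine Finset.prod_congr rfl fun i _ => ?_
    rw [(hfin i).encard_eq_coe_toFinset_card, ENat.toNat_natCast, ← Finset.prod_const]
    refine Finset.prod_congr rfl fun n hn => ?_
    rw [Finite.mem_toFinset] at hn
    rw [hGeq n i hn, ← (hlaw n).map_eq,
      Measure.map_apply_of_aemeasurable (hlaw n).aemeasurable (hR i).compl]
  · intro i _ j _ hij
    simp only [Function.onFun, Finset.disjoint_left, Finite.mem_toFinset, mem_ofPred_eq]
    exact fun n h1 h2 => Set.disjoint_left.1 (hdisj hij) h1 h2

/-- Void probabilities of the marked process over finitely many disjoint rectangles `B i × R i`. -/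
theorem IsModel.measure_void {Ω ι : Type*} [MeasurableSpace Ω] [Fintype ι] {P : Measure Ω}
    [IsProbabilityMeasure P] {d : ℕ} {lam : ℝ≥0} {ν : Measure ℝ} [IsProbabilityMeasure ν]
    {x : ℕ → Ω → (Fin d → ℝ)} {ρ : ℕ → Ω → ℝ} (h : IsModel P d lam ν x ρ)
    {B : ι → Set (Fin d → ℝ)} (hB : ∀ i, MeasurableSet (B i)) (hBo : ∀ i, B i ⊆ openOrthant d)
    (hBv : ∀ i, volume (B i) < ∞) (hdisj : Pairwise fun i j => Disjoint (B i) (B j))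
    {R : ι → Set ℝ} (hR : ∀ i, MeasurableSet (R i)) :
    P {ω | ∀ n i, x n ω ∈ B i → ρ n ω ∉ R i} =
      ENNReal.ofReal (Real.exp (-∑ i, lam * (volume (B i)).toReal * ν.real (R i))) := by
  have hPP := h.1
  have hxm : Measurable fun ω n => x n ω := measurable_pi_lambda _ hPP.measurable
  have hρm : Measurable fun ω n => ρ n ω := measurable_pi_lambda _ h.measurable_side
  set S : Set ((ℕ → Fin d → ℝ) × (ℕ → ℝ)) := {z | ∀ n i, z.1 n ∈ B i → z.2 n ∉ R i} with hS
  have hSm : MeasurableSet S := by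
    have : S = ⋂ n, ⋂ i, ({z | z.1 n ∈ B i}ᶜ ∪ {z | z.2 n ∈ R i}ᶜ) := by
      ext z
      simp only [hS, mem_ofPred_eq, mem_iInter, mem_union, mem_compl_iff, imp_iff_not_or]
    rw [this]
    refine MeasurableSet.iInter fun n => MeasurableSet.iInter fun i => ?_
    have h1 : Measurable fun z : (ℕ → Fin d → ℝ) × (ℕ → ℝ) => z.1 n := by fun_prop
    have h2 : Measurable fun z : (ℕ → Fin d → ℝ) × (ℕ → ℝ) => z.2 n := by fun_prop
    exact (h1 (hB i)).compl.union (h2 (hR i)).compl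
  have hae : ∀ᵐ ω ∂P, ∀ i, {n | x n ω ∈ B i}.Finite := by
    rw [ae_all_iff]
    intro i
    have hl := hPP.hasLaw_pointCount (B i) (hB i) (hBo i) (hBv i)
    have : ∀ᵐ ω ∂P, pointCount x (B i) ω ≠ ⊤ := by
      refine (hl.ae_iff (p := fun k => k ≠ ⊤) (Measurable.of_discrete)).2 ?_
      rw [ae_map_iff .of_discrete .of_discrete]
      exact Eventually.of_forall fun k => ENat.natCast_ne_top k
    filter_upwards [this] with ω hω
    exact Set.encard_ne_top_iff.1 hω
  have hcount : iIndepFun (fun i => pointCount x (B i)) P := by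
    let e := Fintype.equivFin ι
    have h0 := hPP.iIndepFun_pointCount (Fintype.card ι) (fun k => B (e.symm k))
      (fun k => hB _) (fun k => hBo _) (fun k l hkl => hdisj (e.symm.injective.ne hkl))
    have h1 := h0.precomp e.injective
    simpa using h1
  have hlaw : ∀ i, HasLaw (pointCount x (B i))
      ((poissonMeasure (lam * (volume (B i)).toNNReal)).map ((↑) : ℕ → ℕ∞)) P :=
    fun i => hPP.hasLaw_pointCount (B i) (hB i) (hBo i) (hBv i)
  -- The value at `⊤` is harmless because the counts are almost surely finite. `HasLaw` gives only
  -- a.e. measurability, hence the measurable versions `N`.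
  let f : ι → ℕ∞ → ℝ≥0∞ := fun i k => ν (R i)ᶜ ^ k.toNat
  let N : ι → Ω → ℕ∞ := fun i => (hlaw i).aemeasurable.mk
  have hN : ∀ i, pointCount x (B i) =ᵐ[P] N i := fun i => (hlaw i).aemeasurable.ae_eq_mk
  calc P {ω | ∀ n i, x n ω ∈ B i → ρ n ω ∉ R i}
      = P.map (fun ω => ((fun n => x n ω), (fun n => ρ n ω))) S := by
        rw [Measure.map_apply (hxm.prodMk hρm) hSm]; rfl
    _ = ∫⁻ y, P.map (fun ω n => ρ n ω) (Prod.mk y ⁻¹' S) ∂(P.map fun ω n => x n ω) := by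
        rw [(indepFun_iff_map_prod_eq_prod_map_map hxm.aemeasurable hρm.aemeasurable).1 h.indepFun,
          Measure.prod_apply hSm]
    _ = ∫⁻ ω, P.map (fun ω n => ρ n ω) (Prod.mk (fun n => x n ω) ⁻¹' S) ∂P :=
        lintegral_map (measurable_measure_prodMk_left hSm) hxm
    _ = ∫⁻ ω, ∏ i, f i (pointCount x (B i) ω) ∂P := by
        refine lintegral_congr_ae ?_
        filter_upwards [hae] with ω hω
        rw [Measure.map_apply hρm (measurable_prodMk_left hSm)]
        exact measure_forall_notMem_of_finite h.hasLaw_side h.iIndepFun_side hdisj hR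
          (fun n => x n ω) hω
    _ = ∫⁻ ω, ∏ i, f i (N i ω) ∂P := by
        refine lintegral_congr_ae ?_
        filter_upwards [ae_all_iff.2 hN] with ω hω
        simp_rw [hω]
    _ = ∏ i, ∫⁻ ω, f i (N i ω) ∂P :=
        lintegral_prod_eq_prod_lintegral_of_indepFun Finset.univ (fun i ω => f i (N i ω))
          ((hcount.congr hN).comp f fun i => .of_discrete)
          (fun i => (Measurable.of_discrete (f := f i)).comp (hlaw i).aemeasurable.measurable_mk)
    _ = ∏ i, ENNReal.ofReal (Real.exp (-(lam * (volume (B i)).toReal * ν.real (R i)))) := by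
        refine Finset.prod_congr rfl fun i _ => ?_
        have e1 : ∫⁻ ω, f i (N i ω) ∂P = ∫⁻ ω, f i (pointCount x (B i) ω) ∂P := by
          refine lintegral_congr_ae ?_
          filter_upwards [hN i] with ω hω
          rw [hω]
        rw [e1, (hlaw i).lintegral_comp (f := f i) Measurable.of_discrete.aemeasurable,
          lintegral_map .of_discrete .of_discrete]
        have e2 : ν (R i)ᶜ = ENNReal.ofReal (ν.real (R i)ᶜ) := by
          rw [ofReal_measureReal]
        simp only [f, ENat.toNat_natCast, e2]
        rw [lintegral_pow_poissonMeasure _ measureReal_nonneg, probReal_compl_eq_one_sub (hR i)]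
        congr 3
        push_cast
        ring
    _ = _ := by
        rw [← ENNReal.ofReal_prod_of_nonneg fun i _ => (Real.exp_pos _).le, ← Real.exp_sum,
          Finset.sum_neg_distrib]

/-! ### Recurrence of regenerative events. -/

/-- Regenerative events whose probabilities have a divergent sum recur almost surely. -/
theorem ae_frequently_of_renewal {Ω : Type*} [MeasurableSpace Ω] {P : Measure Ω}
    [IsProbabilityMeasure P] {E : ℕ → Set Ω} (hE : ∀ n, MeasurableSet (E n))
    (hE0 : E 0 = univ)
    (hren : ∀ (n : ℕ) (S : Finset ℕ),
      P.real (E n ∩ ⋂ k ∈ S, E (n + k)) = P.real (E n) * P.real (⋂ k ∈ S, E k))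
    (hdiv : ¬ Summable fun n => P.real (E n)) :
    ∀ᵐ ω ∂P, ∃ᶠ n in atTop, ω ∈ E n := by
  classical
  -- Inclusion–exclusion, one complement at a time, extends the renewal identity to non-occurrences.
  have hcompl : ∀ (n : ℕ) (U S : Finset ℕ),
      P.real ((E n ∩ ⋂ k ∈ S, E (n + k)) ∩ ⋂ k ∈ U, (E (n + k))ᶜ) =
        P.real (E n) * P.real ((⋂ k ∈ S, E k) ∩ ⋂ k ∈ U, (E k)ᶜ) := by
    intro n U
    induction U using Finset.induction_on with
    | empty => intro S; simpa using hren n S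
    | insert a U ha ih =>
      intro S
      have split : ∀ (F : ℕ → Set Ω) (A : Set Ω), (∀ k, MeasurableSet (F k)) →
          P.real ((A ∩ ⋂ k ∈ S, F k) ∩ ⋂ k ∈ insert a U, (F k)ᶜ) =
            P.real ((A ∩ ⋂ k ∈ S, F k) ∩ ⋂ k ∈ U, (F k)ᶜ) -
              P.real ((A ∩ ⋂ k ∈ insert a S, F k) ∩ ⋂ k ∈ U, (F k)ᶜ) := by
        intro F A hF
        have h := measureReal_inter_add_sdiff (μ := P)
          (s := (A ∩ ⋂ k ∈ S, F k) ∩ ⋂ k ∈ U, (F k)ᶜ) (hF a)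
        rw [eq_sub_iff_add_eq, ← h, add_comm]
        congr 2
        · ext ω
          simp only [Finset.set_biInter_insert, mem_inter_iff]
          tauto
        · ext ω
          simp only [Finset.set_biInter_insert, mem_inter_iff, Set.mem_sdiff, mem_compl_iff]
          tauto
      have h1 := split (fun k => E (n + k)) (E n) fun k => hE _
      have h2 := split E univ hE
      simp only [univ_inter] at h2
      rw [h1, h2, ih S, ih (insert a S), mul_sub]
  -- `F n` says that the last occurrence is at `n`. These events are disjoint with `P (F n) = P (E
  -- n) * P (D 0)`, so divergence forces `P (D 0) = 0`: almost surely no occurrence is the last.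
  set D : ℕ → Set Ω := fun n => ⋂ k, (E (n + (k + 1)))ᶜ with hD
  set F : ℕ → Set Ω := fun n => E n ∩ D n with hF
  have hlim : ∀ (A : Set Ω) (n : ℕ), MeasurableSet A →
      Tendsto (fun N => P.real (A ∩ ⋂ k ∈ (Finset.range N).map (addRightEmbedding 1),
        (E (n + k))ᶜ)) atTop (nhds (P.real (A ∩ D n))) := by
    intro A n hA
    have hset : ∀ N, A ∩ ⋂ k ∈ (Finset.range N).map (addRightEmbedding 1), (E (n + k))ᶜ =
        A ∩ ⋂ k ∈ Finset.range N, (E (n + (k + 1)))ᶜ := by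
      intro N
      ext ω
      simp
    have hDN : A ∩ D n = ⋂ N, (A ∩ ⋂ k ∈ Finset.range N, (E (n + (k + 1)))ᶜ) := by
      ext ω
      simp only [hD, mem_inter_iff, mem_iInter, Finset.mem_range]
      exact ⟨fun h N => ⟨h.1, fun k _ => h.2 k⟩,
        fun h => ⟨(h 0).1, fun k => (h (k + 1)).2 k (Nat.lt_succ_self k)⟩⟩
    simp_rw [hset]
    rw [hDN]
    refine (ENNReal.tendsto_toReal (measure_ne_top P _)).comp
      (tendsto_measure_iInter_atTop (fun N => ?_) ?_ ⟨0, measure_ne_top _ _⟩)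
    · exact (hA.inter (Finset.measurableSet_biInter _ fun k _ => (hE _).compl)).nullMeasurableSet
    · intro M N hMN
      refine inter_subset_inter_right _ ?_
      exact biInter_subset_biInter_left fun k hk =>
        Finset.mem_range.2 (lt_of_lt_of_le (Finset.mem_range.1 hk) hMN)
  have hDm : ∀ n, MeasurableSet (D n) := fun n => MeasurableSet.iInter fun k => (hE _).compl
  have hFm : ∀ n, MeasurableSet (F n) := fun n => (hE n).inter (hDm n)
  have hFP : ∀ n, P.real (F n) = P.real (E n) * P.real (D 0) := by
    intro n
    refine tendsto_nhds_unique (hlim (E n) n (hE n)) ?_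
    have h0 := (hlim univ 0 MeasurableSet.univ).const_mul (P.real (E n))
    simp only [univ_inter, zero_add] at h0
    refine h0.congr fun N => ?_
    have := hcompl n ((Finset.range N).map (addRightEmbedding 1)) ∅
    simpa using this.symm
  have hdisj : Pairwise (Function.onFun Disjoint F) := by
    have aux : ∀ m n, m < n → Disjoint (F m) (F n) := by
      intro m n hmn
      refine Set.disjoint_left.2 fun ω hm hn => ?_
      have := mem_iInter.1 hm.2 (n - m - 1)
      rw [show m + (n - m - 1 + 1) = n by omega] at this
      exact this hn.1
    intro m n hmn
    rcases lt_or_gt_of_ne hmn with h | h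
    exacts [aux m n h, (aux n m h).symm]
  have hsum : Summable fun n => P.real (F n) := by
    have h1 : ∑' n, P (F n) ≠ ∞ := by
      rw [← measure_iUnion hdisj hFm]; exact measure_ne_top _ _
    exact ENNReal.summable_toReal h1
  have hq : P.real (D 0) = 0 := by
    by_contra hne
    refine hdiv ?_
    have := hsum.mul_right (P.real (D 0))⁻¹
    refine this.congr fun n => ?_
    rw [hFP, mul_assoc, mul_inv_cancel₀ hne, mul_one]
  have hnull : ∀ᵐ ω ∂P, ∀ n, ω ∉ F n := by
    rw [ae_all_iff]
    intro n
    have : P.real (F n) = 0 := by rw [hFP, hq, mul_zero]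
    rw [measureReal_eq_zero_iff] at this
    exact measure_eq_zero_iff_ae_notMem.1 this
  filter_upwards [hnull] with ω hω
  rw [frequently_atTop]
  by_contra hcon
  push Not at hcon
  obtain ⟨a, ha⟩ := hcon
  have hstep : ∀ n, ω ∈ E n → ∃ k, ω ∈ E (n + (k + 1)) := by
    intro n hn
    by_contra hc
    push Not at hc
    exact hω n ⟨hn, mem_iInter.2 hc⟩
  -- `E 0 = univ` supplies the first occurrence; without one, "no last occurrence" would be vacuous.
  have hall : ∀ M, ∃ n, M ≤ n ∧ ω ∈ E n := by
    intro M
    induction M with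
    | zero => exact ⟨0, le_rfl, hE0 ▸ mem_univ ω⟩
    | succ M ih =>
      obtain ⟨n, hn, hnE⟩ := ih
      obtain ⟨k, hk⟩ := hstep n hnE
      exact ⟨n + (k + 1), by omega, hk⟩
  obtain ⟨n, hn, hnE⟩ := hall a
  exact ha n hn hnE

/-! ### Strips along a coordinate axis. -/

/-- The box with side `(lo, hi]` in direction `j` and side `(a k, a k + T]` in direction `k ≠ j`. -/
def strip {d : ℕ} (j : Fin d) (a : Fin d → ℝ) (T lo hi : ℝ) : Set (Fin d → ℝ) :=
  Set.pi univ fun k => Ioc (Function.update a j lo k) (Function.update (fun k => a k + T) j hi k)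

theorem mem_strip {d : ℕ} {j : Fin d} {a : Fin d → ℝ} {T lo hi : ℝ} {y : Fin d → ℝ} :
    y ∈ strip j a T lo hi ↔
      (lo < y j ∧ y j ≤ hi) ∧ ∀ k, k ≠ j → a k < y k ∧ y k ≤ a k + T := by
  simp only [strip, Set.mem_pi, mem_univ, true_implies, mem_Ioc]
  constructor
  · intro h
    refine ⟨by simpa using h j, fun k hk => by simpa [hk] using h k⟩
  · rintro ⟨h1, h2⟩ k
    by_cases hk : k = j
    · subst hk; simpa using h1
    · simpa [hk] using h2 k hk

theorem measurableSet_strip {d : ℕ} (j : Fin d) (a : Fin d → ℝ) (T lo hi : ℝ) :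
    MeasurableSet (strip j a T lo hi) :=
  MeasurableSet.univ_pi fun _ => measurableSet_Ioc

theorem volume_strip {d : ℕ} (j : Fin d) (a : Fin d → ℝ) {T lo hi : ℝ} :
    volume (strip j a T lo hi) = ENNReal.ofReal (hi - lo) * ENNReal.ofReal T ^ (d - 1) := by
  rw [strip, Real.volume_pi_Ioc, ← Finset.mul_prod_erase _ _ (Finset.mem_univ j)]
  congr 1
  · simp
  · rw [Finset.prod_congr rfl (g := fun _ => ENNReal.ofReal T), Finset.prod_const,
      Finset.card_erase_of_mem (Finset.mem_univ j), Finset.card_univ, Fintype.card_fin]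
    intro k hk
    simp [Finset.ne_of_mem_erase hk]

theorem strip_subset_openOrthant {d : ℕ} {j : Fin d} {a : Fin d → ℝ} {T lo hi : ℝ}
    (ha : ∀ k, 0 ≤ a k) (hlo : 0 ≤ lo) : strip j a T lo hi ⊆ openOrthant d := by
  intro y hy k
  rw [mem_strip] at hy
  by_cases hk : k = j
  · subst hk; exact hlo.trans_lt hy.1.1
  · exact (ha k).trans_lt (hy.2 k hk).1

theorem IsModel.measureReal_void_strip {Ω ι : Type*} [MeasurableSpace Ω] [Fintype ι]
    {P : Measure Ω} [IsProbabilityMeasure P] {d : ℕ} {lam : ℝ≥0} {ν : Measure ℝ}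
    [IsProbabilityMeasure ν] {x : ℕ → Ω → (Fin d → ℝ)} {ρ : ℕ → Ω → ℝ}
    (h : IsModel P d lam ν x ρ) (j : Fin d) {a : Fin d → ℝ} (ha : ∀ k, 0 ≤ a k) {T : ℝ}
    (hT : 0 ≤ T) {lo hi : ι → ℝ} (hlo : ∀ i, 0 ≤ lo i) (hlohi : ∀ i, lo i ≤ hi i)
    (hdisj : Pairwise fun i i' => Disjoint (Ioc (lo i) (hi i)) (Ioc (lo i') (hi i')))
    {R : ι → Set ℝ} (hR : ∀ i, MeasurableSet (R i)) :
    P.real {ω | ∀ n i, x n ω ∈ strip j a T (lo i) (hi i) → ρ n ω ∉ R i} =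
      Real.exp (-(lam * T ^ (d - 1) * ∑ i, (hi i - lo i) * ν.real (R i))) := by
  rw [measureReal_def, h.measure_void (fun i => measurableSet_strip j a T (lo i) (hi i))
    (fun i => strip_subset_openOrthant ha (hlo i)) _ _ hR,
    ENNReal.toReal_ofReal (Real.exp_pos _).le, Finset.mul_sum]
  · congr 2
    refine Finset.sum_congr rfl fun i _ => ?_
    rw [volume_strip, ENNReal.toReal_mul, ENNReal.toReal_pow, ENNReal.toReal_ofReal hT,
      ENNReal.toReal_ofReal (sub_nonneg.2 (hlohi i))]
    ring
  · intro i
    rw [volume_strip]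
    exact ENNReal.mul_lt_top ENNReal.ofReal_lt_top (ENNReal.pow_lt_top ENNReal.ofReal_lt_top)
  · intro i i' hii'
    refine Set.disjoint_left.2 fun y h1 h2 => ?_
    exact Set.disjoint_left.1 (hdisj hii') (mem_strip.1 h1).1 (mem_strip.1 h2).1

/-! ### Unreached levels and failure of coverage. -/

/-- The discrete integrated tail `∑_{s < n} P(ρ > s)`. -/
noncomputable def tailSum (ν : Measure ℝ) (n : ℕ) : ℝ := ∑ s ∈ Finset.range n, ν.real (Ioi (s : ℝ))

section Uncovered

variable {Ω : Type*} [MeasurableSpace Ω] {P : Measure Ω} {d : ℕ}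
  {lam : ℝ≥0} {ν : Measure ℝ} {x : ℕ → Ω → (Fin d → ℝ)} {ρ : ℕ → Ω → ℝ}

/-- No point lying in one of the first `n` unit cells of the strip `(0, T]^{d-1}` along direction
`j` has a mark long enough to reach level `n - 1` from the upper end of its cell. -/
def unreached (x : ℕ → Ω → (Fin d → ℝ)) (ρ : ℕ → Ω → ℝ) (j : Fin d) (T : ℝ) (n : ℕ) : Set Ω :=
  {ω | ∀ m, ∀ i < n, x m ω ∈ strip j 0 T i (i + 1) → ρ m ω ∉ Ioi ((n : ℝ) - i - 2)}

/-- The marks forbidden in cell `i` when every level of `S` is unreached. -/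
def reachingMarks (S : Finset ℕ) (i : ℕ) : Set ℝ :=
  ⋃ k ∈ S, ⋃ (_ : i < k), Ioi ((k : ℝ) - i - 2)

theorem mem_reachingMarks {S : Finset ℕ} {i : ℕ} {r : ℝ} :
    r ∈ reachingMarks S i ↔ ∃ k ∈ S, i < k ∧ (k : ℝ) - i - 2 < r := by
  simp [reachingMarks, and_left_comm]

theorem measurableSet_reachingMarks (S : Finset ℕ) (i : ℕ) : MeasurableSet (reachingMarks S i) :=
  Finset.measurableSet_biUnion _ fun _ _ => MeasurableSet.iUnion fun _ => measurableSet_Ioi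

theorem disjoint_unit_Ioc {i i' : ℕ} (h : i ≠ i') :
    Disjoint (Ioc (i : ℝ) (i + 1)) (Ioc (i' : ℝ) (i' + 1)) := by
  refine Set.disjoint_left.2 fun y h1 h2 => ?_
  rcases lt_or_gt_of_ne h with h | h
  · have : (i : ℝ) + 1 ≤ i' := by exact_mod_cast h
    linarith [h1.2, h2.1]
  · have : (i' : ℝ) + 1 ≤ i := by exact_mod_cast h
    linarith [h2.2, h1.1]

theorem IsModel.measurableSet_unreached (h : IsModel P d lam ν x ρ) (j : Fin d) (T : ℝ) (n : ℕ) :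
    MeasurableSet (unreached x ρ j T n) := by
  have : unreached x ρ j T n = ⋂ m, ⋂ i, ⋂ (_ : i < n),
      ((x m ⁻¹' strip j 0 T i (i + 1))ᶜ ∪ (ρ m ⁻¹' Ioi ((n : ℝ) - i - 2))ᶜ) := by
    ext ω
    simp only [unreached, mem_ofPred_eq, mem_iInter, mem_union, mem_compl_iff, mem_preimage,
      imp_iff_not_or]
  rw [this]
  exact MeasurableSet.iInter fun m => MeasurableSet.iInter fun i => MeasurableSet.iInter fun _ =>
    ((h.1.measurable m) (measurableSet_strip ..)).compl.union
      ((h.measurable_side m) measurableSet_Ioi).compl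

variable [IsProbabilityMeasure P] [IsProbabilityMeasure ν]

theorem IsModel.measureReal_unreached (h : IsModel P d lam ν x ρ) (j : Fin d) {T : ℝ} (hT : 0 ≤ T)
    {S : Finset ℕ} {N : ℕ} (hN : ∀ k ∈ S, k ≤ N) :
    P.real (⋂ k ∈ S, unreached x ρ j T k) =
      Real.exp (-(lam * T ^ (d - 1) * ∑ i ∈ Finset.range N, ν.real (reachingMarks S i))) := by
  have hset : (⋂ k ∈ S, unreached x ρ j T k) =
      {ω | ∀ m (i : Fin N), x m ω ∈ strip j 0 T ((i : ℕ) : ℝ) ((i : ℕ) + 1) →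
        ρ m ω ∉ reachingMarks S i} := by
    ext ω
    simp only [mem_iInter, unreached, mem_ofPred_eq, mem_reachingMarks, mem_Ioi]
    constructor
    · rintro h m i hi ⟨k, hk, hik, hr⟩
      exact h k hk m i hik hi hr
    · intro h k hk m i hik hi hr
      exact h m ⟨i, hik.trans_le (hN k hk)⟩ hi ⟨k, hk, hik, hr⟩
  rw [hset, h.measureReal_void_strip j (a := 0) (fun _ => le_rfl) hT (fun i => by positivity)
    (fun i => by linarith)
    (fun i i' hii' => disjoint_unit_Ioc fun hc => hii' (Fin.ext hc))
    (fun i => measurableSet_reachingMarks S i)]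
  rw [Finset.sum_range]
  simp

/-- In a cell below `n`, level `n` imposes the lowest mark bound, so later levels add nothing there.
In cells from `n` on, level `n` imposes nothing, and the other bounds depend only on level minus
cell, hence are translates. -/
theorem IsModel.unreached_renewal (h : IsModel P d lam ν x ρ) (j : Fin d) {T : ℝ} (hT : 0 ≤ T)
    (n : ℕ) (S : Finset ℕ) :
    P.real (unreached x ρ j T n ∩ ⋂ k ∈ S, unreached x ρ j T (n + k)) =
      P.real (unreached x ρ j T n) * P.real (⋂ k ∈ S, unreached x ρ j T k) := by
  classical
  set N := S.sup id
  have hN : ∀ k ∈ S, k ≤ N := fun k hk => Finset.le_sup (f := id) hk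
  set S' := insert n (S.image (n + ·)) with hS'
  have e1 : unreached x ρ j T n ∩ ⋂ k ∈ S, unreached x ρ j T (n + k) =
      ⋂ k ∈ S', unreached x ρ j T k := by
    ext ω
    simp [hS']
  have e2 : unreached x ρ j T n = ⋂ k ∈ ({n} : Finset ℕ), unreached x ρ j T k := by simp
  have hN' : ∀ k ∈ S', k ≤ n + N := by
    intro k hk
    simp only [hS', Finset.mem_insert, Finset.mem_image] at hk
    rcases hk with rfl | ⟨k', hk', rfl⟩
    · exact Nat.le_add_right _ _
    · exact Nat.add_le_add_left (hN k' hk') n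
  rw [e1, h.measureReal_unreached j hT hN', e2, h.measureReal_unreached j hT (N := n) (by simp),
    h.measureReal_unreached j hT hN, ← Real.exp_add, Finset.sum_range_add]
  congr 1
  have h1 : ∀ i ∈ Finset.range n, ν.real (reachingMarks S' i) = ν.real (reachingMarks {n} i) := by
    intro i hi
    congr 1
    ext r
    simp only [mem_reachingMarks, hS', Finset.mem_insert, Finset.mem_image, Finset.mem_singleton]
    constructor
    · rintro ⟨k, hk, -, hr⟩
      refine ⟨n, rfl, Finset.mem_range.1 hi, lt_of_le_of_lt ?_ hr⟩
      have : n ≤ k := by rcases hk with rfl | ⟨k', -, rfl⟩ <;> omega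
      have : (n : ℝ) ≤ k := by exact_mod_cast this
      linarith
    · rintro ⟨k, rfl, hik, hr⟩
      exact ⟨k, Or.inl rfl, hik, hr⟩
  have h2 : ∀ i, ν.real (reachingMarks S' (n + i)) = ν.real (reachingMarks S i) := by
    intro i
    congr 1
    ext r
    simp only [mem_reachingMarks, hS', Finset.mem_insert, Finset.mem_image]
    constructor
    · rintro ⟨k, rfl | ⟨k', hk', rfl⟩, hik, hr⟩
      · omega
      · refine ⟨k', hk', by omega, ?_⟩
        push_cast at hr
        linarith
    · rintro ⟨k, hk, hik, hr⟩
      refine ⟨n + k, Or.inr ⟨k, hk, rfl⟩, by omega, ?_⟩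
      push_cast
      linarith
  rw [Finset.sum_congr rfl h1, Finset.sum_congr rfl fun i _ => h2 i]
  ring

theorem IsModel.exp_tailSum_le_measureReal_unreached (h : IsModel P d lam ν x ρ) (j : Fin d)
    {T : ℝ} (hT : 0 ≤ T) (n : ℕ) :
    Real.exp (-(lam * T ^ (d - 1) * tailSum ν n)) ≤
      Real.exp (lam * T ^ (d - 1)) * P.real (unreached x ρ j T n) := by
  have e2 : unreached x ρ j T n = ⋂ k ∈ ({n} : Finset ℕ), unreached x ρ j T k := by simp
  rw [e2, h.measureReal_unreached j hT (N := n) (by simp), ← Real.exp_add, Real.exp_le_exp]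
  have hc : 0 ≤ (lam : ℝ) * T ^ (d - 1) := by positivity
  -- Under `s = n - 1 - i` the bound `n - i - 2` becomes `s - 1`: the tail sum shifted by one place,
  -- whose extra term is at most `1`.
  have key : ∑ i ∈ Finset.range n, ν.real (reachingMarks {n} i) ≤ 1 + tailSum ν n := by
    have h1 : ∑ i ∈ Finset.range n, ν.real (reachingMarks {n} i) =
        ∑ s ∈ Finset.range n, ν.real (Ioi ((s : ℝ) - 1)) := by
      rw [← Finset.sum_range_reflect]
      refine Finset.sum_congr rfl fun i hi => ?_
      congr 1
      rw [Finset.mem_range] at hi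
      have hcast : ((n - 1 - i : ℕ) : ℝ) = n - 1 - i := by
        rw [Nat.cast_sub (by omega), Nat.cast_sub (by omega)]; simp
      ext r
      simp only [mem_reachingMarks, Finset.mem_singleton, mem_Ioi, hcast]
      constructor
      · rintro ⟨k, rfl, -, hr⟩
        linarith
      · intro hr
        exact ⟨n, rfl, by omega, by linarith⟩
    rw [h1, tailSum]
    cases n with
    | zero => simp
    | succ n =>
      rw [Finset.sum_range_succ', Finset.sum_range_succ]
      have : ν.real (Ioi (((0 : ℕ) : ℝ) - 1)) ≤ 1 := measureReal_le_one
      have h3 : ∀ i ∈ Finset.range n,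
          ν.real (Ioi (((i + 1 : ℕ) : ℝ) - 1)) = ν.real (Ioi (i : ℝ)) := by
        intro i _
        congr 2
        push_cast
        ring
      rw [Finset.sum_congr rfl h3]
      have : 0 ≤ ν.real (Ioi (n : ℝ)) := measureReal_nonneg
      linarith
  nlinarith

theorem IsModel.ae_not_eventuallyDoublyCovered (h : IsModel P d lam ν x ρ) (j : Fin d)
    (hdiv : ∀ T : ℕ,
      ¬ Summable fun n => Real.exp (-(lam * (T : ℝ) ^ (d - 1) * tailSum ν n))) :
    ∀ᵐ ω ∂P, ¬ EventuallyDoublyCovered (fun n => x n ω) (fun n => ρ n ω) := by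
  have hio : ∀ᵐ ω ∂P, ∀ T : ℕ, ∃ᶠ n in atTop, ω ∈ unreached x ρ j T n := by
    rw [ae_all_iff]
    intro T
    refine ae_frequently_of_renewal (fun n => h.measurableSet_unreached j T n) ?_
      (fun n S => h.unreached_renewal j T.cast_nonneg n S) fun hs => hdiv T ?_
    · ext ω; simp [unreached]
    · exact Summable.of_nonneg_of_le (fun n => (Real.exp_pos _).le)
        (fun n => h.exp_tailSum_le_measureReal_unreached j T.cast_nonneg n) (hs.mul_left _)
  filter_upwards [hio, ae_all_iff.2 h.1.mem_openOrthant] with ω hω hpos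
  rintro ⟨t, ht, hcov⟩
  obtain ⟨T, hT⟩ := exists_nat_ge (∑ k, t k)
  have htT : ∀ k, t k ≤ T := fun k =>
    (Finset.single_le_sum (fun k _ => ht k) (Finset.mem_univ k)).trans hT
  obtain ⟨n, hTn, hn⟩ := (frequently_atTop.1 (hω T)) T
  -- A cube containing this `z` has its corner in the strip of width `T`, at height at most `n`, and
  -- must reach level `n`, which `unreached` forbids.
  set z : Fin d → ℝ := Function.update (fun _ => (T : ℝ)) j n with hz
  have htz : ∀ k, 0 ≤ (z - t) k := by
    intro k
    rw [Pi.sub_apply, sub_nonneg, hz]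
    by_cases hk : k = j
    · subst hk
      simpa using (htT k).trans (by exact_mod_cast hTn)
    · simpa [hk] using htT k
  have hD := hcov (z - t) htz
  rw [add_sub_cancel] at hD
  obtain ⟨-, m, -, -, hm, -⟩ := hD
  have hxj : 0 < x m ω j := hpos m j
  have hzj : z j = n := by simp [hz]
  have hmj := hm j
  rw [hzj] at hmj
  obtain ⟨i, hi⟩ : ∃ i : ℕ, ⌈x m ω j⌉₊ = i + 1 :=
    Nat.exists_eq_succ_of_ne_zero (Nat.ceil_pos.2 hxj).ne'
  have hi1 : (i : ℝ) < x m ω j := Nat.lt_ceil.1 (by omega)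
  have hi2 : x m ω j ≤ i + 1 := by
    have := Nat.le_ceil (x m ω j)
    rw [hi] at this
    exact_mod_cast this
  have hin : i < n := by exact_mod_cast hi1.trans_le hmj.1
  have hmem : x m ω ∈ strip j 0 (T : ℝ) i (i + 1) := by
    refine mem_strip.2 ⟨⟨hi1, hi2⟩, fun k hk => ⟨hpos m k, ?_⟩⟩
    have := (hm k).1
    simpa [hz, hk] using this
  have := hn m i hin hmem
  rw [mem_Ioi, not_lt] at this
  linarith [hmj.2]

end Uncovered

/-! ### Double covering of lattice cubes. -/

theorem tailSum_mono (ν : Measure ℝ) : Monotone (tailSum ν) := by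
  intro m n hmn
  exact Finset.sum_le_sum_of_subset_of_nonneg (Finset.range_subset_range.2 hmn)
    fun _ _ _ => measureReal_nonneg

theorem tailSum_nonneg (ν : Measure ℝ) (n : ℕ) : 0 ≤ tailSum ν n :=
  Finset.sum_nonneg fun _ _ => measureReal_nonneg

theorem tailSum_le (ν : Measure ℝ) [IsProbabilityMeasure ν] (n : ℕ) : tailSum ν n ≤ n := by
  calc tailSum ν n ≤ ∑ _s ∈ Finset.range n, (1 : ℝ) :=
        Finset.sum_le_sum fun _ _ => measureReal_le_one
    _ = n := by simp

/-- The cube `z + [0, 1]^d` lies in two cubes of the configuration with distinct corners. -/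
def CubeDoublyCovered {d : ℕ} (a : ℕ → (Fin d → ℝ)) (r : ℕ → ℝ) (z : Fin d → ℕ) : Prop :=
  ∃ i i', a i ≠ a i' ∧ cube (fun k => (z k : ℝ)) 1 ⊆ cube (a i) (r i) ∩ cube (a i') (r i')

section Covered

variable {Ω : Type*} [MeasurableSpace Ω] {P : Measure Ω} [IsProbabilityMeasure P] {d : ℕ}
  {lam : ℝ≥0} {ν : Measure ℝ} [IsProbabilityMeasure ν] {x : ℕ → Ω → (Fin d → ℝ)} {ρ : ℕ → Ω → ℝ}

theorem disjoint_subcell_Ioc {K : ℕ} {i i' b b' : ℕ} (hb : b < K) (hb' : b' < K)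
    (h : i ≠ i' ∨ b ≠ b') :
    Disjoint (Ioc ((i : ℝ) + b / K) (i + (b + 1) / K)) (Ioc ((i' : ℝ) + b' / K) (i' + (b' + 1) / K))
    := by
  have hK : (0 : ℝ) < K := by exact_mod_cast (Nat.zero_le b).trans_lt hb
  have aux : ∀ i i' b b' : ℕ, b < K → (i < i' ∨ i = i' ∧ b < b') →
      (i : ℝ) + (b + 1) / K ≤ i' + b' / K := by
    intro i i' b b' hb h
    rcases h with h | ⟨rfl, h⟩
    · have h1 : ((b : ℝ) + 1) / K ≤ 1 := by
        rw [div_le_one hK]; exact_mod_cast hb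
      have h2 : (i : ℝ) + 1 ≤ i' := by exact_mod_cast h
      have h3 : 0 ≤ (b' : ℝ) / K := by positivity
      linarith
    · have h1 : (b : ℝ) + 1 ≤ b' := by exact_mod_cast h
      gcongr
  refine Set.disjoint_left.2 fun y h1 h2 => ?_
  have hcases : (i < i' ∨ i = i' ∧ b < b') ∨ (i' < i ∨ i' = i ∧ b' < b) := by omega
  rcases hcases with hc | hc
  · linarith [aux i i' b b' hb hc, h1.2, h2.1]
  · linarith [aux i' i b' b hb' hc, h2.2, h1.1]

/-- No point outside the subcells of class `a` of the first `z j - T` unit cells of the strip below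
`z` has a mark long enough to cover `z + [0, 1]^d`. -/
def voidExcept (x : ℕ → Ω → (Fin d → ℝ)) (ρ : ℕ → Ω → ℝ) (j : Fin d) (T K : ℕ) (z : Fin d → ℕ)
    (a : Fin K) : Set Ω :=
  {ω | ∀ n (q : Fin (z j - T) × {b : Fin K // b ≠ a}),
    x n ω ∈ strip j (fun k => (z k : ℝ) - T) T (((q.1 : ℕ) : ℝ) + ((q.2 : Fin K) : ℕ) / K)
      (((q.1 : ℕ) : ℝ) + (((q.2 : Fin K) : ℕ) + 1) / K) →
    ρ n ω ∉ Ioi ((z j : ℝ) + 1 - (q.1 : ℕ))}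

/-- Removing one of `K` classes keeps the fraction `1 - 1 / K` of each cell. The cells used
contribute the tails from `T + 2` to `z j + 1`; the missing initial terms total at most `T + 2`. -/
theorem IsModel.measureReal_voidExcept_le (h : IsModel P d lam ν x ρ) (j : Fin d) {T K : ℕ}
    {z : Fin d → ℕ} (hz : ∀ k, T ≤ z k) (a : Fin K) :
    P.real (voidExcept x ρ j T K z a) ≤
      Real.exp (-(lam * (T : ℝ) ^ (d - 1) * (1 - 1 / K) * (tailSum ν (z j) - (T + 2)))) := by
  have hK : (0 : ℝ) < K := by exact_mod_cast a.pos
  rw [voidExcept, h.measureReal_void_strip j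
    (fun k => by rw [sub_nonneg]; exact_mod_cast hz k) T.cast_nonneg
    (fun q => by positivity) (fun q => by gcongr; linarith) _ (fun q => measurableSet_Ioi)]
  · rw [Real.exp_le_exp, neg_le_neg_iff, mul_assoc]
    refine mul_le_mul_of_nonneg_left ?_ (by positivity)
    rw [Fintype.sum_prod_type]
    have hcard : Fintype.card {b : Fin K // b ≠ a} = K - 1 := by
      rw [Fintype.card_subtype_compl]; simp
    have hcast : ((K - 1 : ℕ) : ℝ) = K - 1 := by
      rw [Nat.cast_sub a.pos]; simp
    have hinner : ∀ i : Fin (z j - T), ∑ q : {b : Fin K // b ≠ a},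
        (((i : ℕ) : ℝ) + (((q : Fin K) : ℕ) + 1) / K - (((i : ℕ) : ℝ) + ((q : Fin K) : ℕ) / K)) *
          ν.real (Ioi ((z j : ℝ) + 1 - (i : ℕ))) =
        (1 - 1 / K) * ν.real (Ioi ((z j : ℝ) + 1 - (i : ℕ))) := by
      intro i
      rw [← Finset.sum_mul]
      congr 1
      rw [Finset.sum_congr rfl (g := fun _ => (1 : ℝ) / K) fun q _ => by ring, Finset.sum_const,
        Finset.card_univ, hcard, nsmul_eq_mul, hcast]
      field_simp
    rw [Finset.sum_congr rfl fun i _ => hinner i, ← Finset.mul_sum]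
    refine mul_le_mul_of_nonneg_left ?_ ?_
    · have e1 : ∑ i : Fin (z j - T), ν.real (Ioi ((z j : ℝ) + 1 - (i : ℕ))) =
          ∑ i ∈ Finset.range (z j - T), ν.real (Ioi (((T + 2 + i : ℕ)) : ℝ)) := by
        rw [← Finset.sum_range_reflect, Finset.sum_range]
        refine Finset.sum_congr rfl fun i _ => ?_
        congr 2
        have : T + 2 + (z j - T - 1 - (i : ℕ)) + i = z j + 1 := by omega
        have : (((T + 2 + (z j - T - 1 - (i : ℕ)) : ℕ) : ℝ)) + ((i : ℕ) : ℝ) = (z j : ℝ) + 1 := by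
          exact_mod_cast this
        linarith
      have e2 : tailSum ν (T + 2 + (z j - T)) = tailSum ν (T + 2) +
          ∑ i ∈ Finset.range (z j - T), ν.real (Ioi (((T + 2 + i : ℕ)) : ℝ)) := by
        rw [tailSum, Finset.sum_range_add, tailSum]
      have e3 : tailSum ν (z j) ≤ tailSum ν (T + 2 + (z j - T)) := tailSum_mono ν (by omega)
      have e4 := tailSum_le ν (T + 2)
      push_cast at e4
      rw [e1]
      linarith
    · rw [sub_nonneg, div_le_one hK]
      exact_mod_cast a.pos
  · rintro ⟨i, b⟩ ⟨i', b'⟩ hne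
    refine disjoint_subcell_Ioc b.1.2 b'.1.2 ?_
    by_contra hc
    push Not at hc
    exact hne (Prod.ext (Fin.ext hc.1) (Subtype.ext (Fin.ext hc.2)))

/-- A covering point exists in some class `b`; excluding `b` produces another in a class `b' ≠ b`.
Disjoint subcells make the two points distinct. -/
theorem cubeDoublyCovered_of_notMem_voidExcept {Ω : Type*} {d : ℕ} {x : ℕ → Ω → (Fin d → ℝ)}
    {ρ : ℕ → Ω → ℝ} {j : Fin d} {T K : ℕ} (hK : 0 < K)
    {z : Fin d → ℕ} {ω : Ω} (hω : ∀ a, ω ∉ voidExcept x ρ j T K z a) :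
    CubeDoublyCovered (fun n => x n ω) (fun n => ρ n ω) z := by
  have hKr : (0 : ℝ) < K := by exact_mod_cast hK
  have hcov : ∀ a : Fin K, ∃ b : Fin K, b ≠ a ∧ ∃ n, ∃ i : ℕ,
      (((i : ℝ) + (b : ℕ) / K < x n ω j ∧ x n ω j ≤ i + ((b : ℕ) + 1) / K)) ∧
      cube (fun k => (z k : ℝ)) 1 ⊆ cube (x n ω) (ρ n ω) := by
    intro a
    have ha := hω a
    simp only [voidExcept, mem_ofPred_eq, not_forall, not_not] at ha
    obtain ⟨n, ⟨i, b⟩, hmem, hρ⟩ := ha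
    rw [mem_strip] at hmem
    simp only [mem_Ioi] at hρ hmem
    refine ⟨b, b.2, n, i, hmem.1, fun y hy k => ?_⟩
    -- Stopping `T` cells below `z j` makes the mark exceed `T + 2`, enough to cover the cube in the
    -- transverse directions too.
    have hi : ((i : ℕ) : ℝ) + 1 + T ≤ z j := by
      have : (i : ℕ) + 1 + T ≤ z j := by have := i.2; omega
      exact_mod_cast this
    have hb1 : (((b : Fin K) : ℕ) + 1 : ℝ) / K ≤ 1 := by
      rw [div_le_one hKr]; exact_mod_cast b.1.2
    have hb0 : (0 : ℝ) ≤ (((b : Fin K) : ℕ) : ℝ) / K := by positivity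
    have hT0 : (0 : ℝ) ≤ T := T.cast_nonneg
    have hyk := hy k
    by_cases hk : k = j
    · subst hk
      constructor <;> linarith [hmem.1.1, hmem.1.2, hyk.1, hyk.2]
    · have := hmem.2 k hk
      constructor <;> linarith [this.1, this.2, hyk.1, hyk.2]
  obtain ⟨b, -, n, i, hn, hc⟩ := hcov ⟨0, hK⟩
  obtain ⟨b', hbb', n', i', hn', hc'⟩ := hcov b
  refine ⟨n, n', fun heq => ?_, subset_inter hc hc'⟩
  have hdis := disjoint_subcell_Ioc (i := i) (i' := i') b.2 b'.2
    (Or.inr fun hc => hbb' (Fin.ext hc.symm))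
  refine Set.disjoint_left.1 hdis hn ?_
  simp only at heq
  rw [heq]
  exact hn'

theorem IsModel.measureReal_not_cubeDoublyCovered_le (h : IsModel P d lam ν x ρ) (j : Fin d)
    {T K : ℕ} (hK : 0 < K) {z : Fin d → ℕ} (hz : ∀ k, T ≤ z k) :
    P.real {ω | ¬ CubeDoublyCovered (fun n => x n ω) (fun n => ρ n ω) z} ≤
      K * Real.exp (-(lam * (T : ℝ) ^ (d - 1) * (1 - 1 / K) * (tailSum ν (z j) - (T + 2)))) := by
  calc P.real {ω | ¬ CubeDoublyCovered (fun n => x n ω) (fun n => ρ n ω) z}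
      ≤ P.real (⋃ a, voidExcept x ρ j T K z a) := by
        refine measureReal_mono fun ω hω => ?_
        by_contra hc
        rw [mem_iUnion, not_exists] at hc
        exact hω (cubeDoublyCovered_of_notMem_voidExcept hK hc)
    _ ≤ ∑ a, P.real (voidExcept x ρ j T K z a) := measureReal_iUnion_fintype_le _
    _ ≤ ∑ _a : Fin K,
        Real.exp (-(lam * (T : ℝ) ^ (d - 1) * (1 - 1 / K) * (tailSum ν (z j) - (T + 2)))) :=
        Finset.sum_le_sum fun a _ => h.measureReal_voidExcept_le j hz a
    _ = _ := by simp

theorem summable_prod_pi {d : ℕ} {f : ℕ → ℝ} (hf0 : ∀ n, 0 ≤ f n) (hf : Summable f) :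
    Summable fun z : Fin d → ℕ => ∏ k, f (z k) := by
  classical
  refine summable_of_sum_le (c := ∏ _k : Fin d, ∑' n, f n)
    (fun z => Finset.prod_nonneg fun k _ => hf0 _) fun u => ?_
  set N := u.sup fun z => Finset.univ.sup z
  have hsub : u ⊆ Fintype.piFinset fun _ : Fin d => Finset.range (N + 1) := by
    intro z hz
    rw [Fintype.mem_piFinset]
    intro k
    rw [Finset.mem_range, Nat.lt_succ_iff]
    exact (Finset.le_sup (f := z) (Finset.mem_univ k)).trans
      (Finset.le_sup (f := fun z : Fin d → ℕ => Finset.univ.sup z) hz)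
  calc ∑ z ∈ u, ∏ k, f (z k)
      ≤ ∑ z ∈ Fintype.piFinset fun _ : Fin d => Finset.range (N + 1), ∏ k, f (z k) :=
        Finset.sum_le_sum_of_subset_of_nonneg hsub
          fun z _ _ => Finset.prod_nonneg fun k _ => hf0 _
    _ = ∏ _k : Fin d, ∑ n ∈ Finset.range (N + 1), f n := by
        rw [Finset.prod_univ_sum]
    _ ≤ ∏ _k : Fin d, ∑' n, f n :=
        Finset.prod_le_prod (fun k _ => Finset.sum_nonneg fun n _ => hf0 n)
          fun k _ => hf.sum_le_tsum _ fun n _ => hf0 n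

/-- For each `z` the strip runs along its largest coordinate `z j`. Since `d * tailSum ν (z j)`
dominates the sum of all `tailSum ν (z k)`, the failure bound factorises over coordinates and is
summable over the lattice; this is the source of the factor `d` in `hT`. -/
theorem IsModel.ae_eventuallyDoublyCovered (h : IsModel P d lam ν x ρ) (hd : 0 < d) {θ : ℝ}
    (hθ : 0 ≤ θ) (hsum : Summable fun n => Real.exp (-(θ * tailSum ν n))) {T : ℕ}
    (hT : θ * d < lam * (T : ℝ) ^ (d - 1)) :
    ∀ᵐ ω ∂P, EventuallyDoublyCovered (fun n => x n ω) (fun n => ρ n ω) := by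
  obtain ⟨K, hK, hKθ⟩ : ∃ K : ℕ, 0 < K ∧ θ * d ≤ lam * (T : ℝ) ^ (d - 1) * (1 - 1 / K) := by
    have hlim : Tendsto (fun K : ℕ => lam * (T : ℝ) ^ (d - 1) * (1 - 1 / (K : ℝ))) atTop
        (nhds (lam * (T : ℝ) ^ (d - 1) * (1 - 0))) :=
      (tendsto_const_nhds.sub tendsto_one_div_atTop_nhds_zero_nat).const_mul _
    rw [sub_zero, mul_one] at hlim
    obtain ⟨K, hK1, hK2⟩ := ((hlim.eventually (lt_mem_nhds hT)).and (eventually_gt_atTop 0)).exists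
    exact ⟨K, hK2, hK1.le⟩
  set c : ℝ := lam * (T : ℝ) ^ (d - 1) * (1 - 1 / K) with hc
  have hdr : (0 : ℝ) < d := by exact_mod_cast hd
  have : Nonempty (Fin d) := ⟨⟨0, hd⟩⟩
  set A : (Fin d → ℕ) → Set Ω := fun z =>
    {ω | (∀ k, T ≤ z k) ∧ ¬ CubeDoublyCovered (fun n => x n ω) (fun n => ρ n ω) z} with hA
  have hAle : ∀ z, P.real (A z) ≤
      K * Real.exp (c * (T + 2)) * ∏ k, Real.exp (-(θ * tailSum ν (z k))) := by
    intro z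
    by_cases hz : ∀ k, T ≤ z k
    · obtain ⟨j, hj⟩ := Finite.exists_max z
      have hle : ∑ k, tailSum ν (z k) ≤ d * tailSum ν (z j) := by
        calc ∑ k, tailSum ν (z k) ≤ ∑ _k : Fin d, tailSum ν (z j) :=
              Finset.sum_le_sum fun k _ => tailSum_mono ν (hj k)
          _ = _ := by simp
      calc P.real (A z)
          ≤ P.real {ω | ¬ CubeDoublyCovered (fun n => x n ω) (fun n => ρ n ω) z} :=
            measureReal_mono fun ω hω => hω.2
        _ ≤ K * Real.exp (-(c * (tailSum ν (z j) - (T + 2)))) :=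
            h.measureReal_not_cubeDoublyCovered_le j hK hz
        _ ≤ K * (Real.exp (c * (T + 2)) * ∏ k, Real.exp (-(θ * tailSum ν (z k)))) := by
            rw [← Real.exp_sum, ← Real.exp_add]
            gcongr
            rw [Finset.sum_neg_distrib, ← Finset.mul_sum]
            have h1 := mul_le_mul_of_nonneg_left hle hθ
            have h2 := mul_le_mul_of_nonneg_right hKθ (tailSum_nonneg ν (z j))
            linarith
        _ = _ := by ring
    · have : A z = ∅ := by
        ext ω
        simp only [hA, mem_ofPred_eq, mem_empty_iff_false, iff_false, not_and]
        exact fun hz' => absurd hz' hz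
      rw [this, measureReal_empty]
      positivity
  have hAsum : ∑' z, P (A z) ≠ ∞ := by
    have hs : Summable fun z => P.real (A z) :=
      Summable.of_nonneg_of_le (fun z => measureReal_nonneg) hAle
        ((summable_prod_pi (fun n => (Real.exp_pos _).le) hsum).mul_left _)
    have := hs.tsum_ofReal_ne_top
    rwa [tsum_congr fun z => ofReal_measureReal] at this
  filter_upwards [ae_finite_setOfPred_mem hAsum] with ω hω
  obtain ⟨M, hM⟩ : ∃ M : ℕ, ∀ z, ω ∈ A z → ∀ k, z k < M := by
    refine ⟨(hω.toFinset.sup fun z => Finset.univ.sup z) + 1, fun z hz k => ?_⟩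
    rw [Nat.lt_succ_iff]
    exact (Finset.le_sup (f := z) (Finset.mem_univ k)).trans
      (Finset.le_sup (f := fun z : Fin d → ℕ => Finset.univ.sup z) (hω.mem_toFinset.2 hz))
  -- Beyond this corner all integer parts are at least `T` and exceed `M`, so the lattice cube
  -- containing the point is not exceptional.
  refine ⟨fun _ => ((M + T + 1 : ℕ) : ℝ), fun _ => Nat.cast_nonneg _, fun y hy => ?_⟩
  set u : Fin d → ℝ := (fun _ => ((M + T + 1 : ℕ) : ℝ)) + y with hu
  have hule : ∀ k, ((M + T + 1 : ℕ) : ℝ) ≤ u k := fun k => le_add_of_nonneg_right (hy k)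
  have hu0 : ∀ k, 0 < u k := fun k => lt_of_lt_of_le (by positivity) (hule k)
  have hfl : ∀ k, M + T + 1 ≤ ⌊u k⌋₊ := fun k => Nat.le_floor (hule k)
  have hcube : CubeDoublyCovered (fun n => x n ω) (fun n => ρ n ω) fun k => ⌊u k⌋₊ := by
    by_contra hcon
    have hmem : ω ∈ A fun k => ⌊u k⌋₊ := 
      ⟨fun k => (show T ≤ M + T + 1 by omega).trans (hfl k), hcon⟩
    have h1 : ⌊u ⟨0, hd⟩⌋₊ < M := hM _ hmem ⟨0, hd⟩
    have h2 := hfl ⟨0, hd⟩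
    omega
  obtain ⟨i, i', hne, hsub⟩ := hcube
  exact ⟨hu0, i, i', hne, hsub fun k => ⟨Nat.floor_le (hu0 k).le, (Nat.lt_floor_add_one _).le⟩⟩

end Covered

/-! ### Comparison of the tail sum with harmonic numbers. -/

section Tails

variable {ν : Measure ℝ}

theorem harmonic_le_tailSum_succ {b : ℝ} (hb : 0 ≤ b) {n₀ : ℕ}
    (h : ∀ n : ℕ, n₀ ≤ n + 1 → b / (n + 1) ≤ ν.real (Ioi ((n + 1 : ℕ) : ℝ))) (n : ℕ) :
    b * harmonic n - b * n₀ ≤ tailSum ν (n + 1) := by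
  induction n with
  | zero =>
    have := tailSum_nonneg ν 1
    simp only [harmonic_zero, zero_add, Rat.cast_zero, mul_zero]
    have : 0 ≤ b * n₀ := by positivity
    linarith
  | succ n ih =>
    by_cases hn : n₀ ≤ n + 1
    · have := h n hn
      rw [harmonic_succ]
      push_cast
      rw [tailSum, Finset.sum_range_succ, ← tailSum]
      rw [div_eq_mul_inv] at this
      linarith
    -- Before `n₀` the left side is nonpositive, so the subtracted `b * n₀` settles this case.
    · have h1 : (harmonic (n + 1) : ℝ) ≤ n₀ := by
        have h2 : harmonic (n + 1) ≤ ((n + 1 : ℕ) : ℚ) := by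
          calc harmonic (n + 1) ≤ ∑ _i ∈ Finset.range (n + 1), (1 : ℚ) :=
                Finset.sum_le_sum fun i _ => inv_le_one_of_one_le₀ (by simp)
            _ = _ := by simp
        have h3 : ((n + 1 : ℕ) : ℚ) ≤ n₀ := by exact_mod_cast (by omega : n + 1 ≤ n₀)
        exact_mod_cast h2.trans h3
      have h2 := tailSum_nonneg ν (n + 1 + 1)
      have h3 := mul_le_mul_of_nonneg_left h1 hb
      linarith

variable [IsProbabilityMeasure ν]

theorem tailSum_succ_le_harmonic {a : ℝ} (ha : 0 ≤ a) {n₀ : ℕ}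
    (h : ∀ n : ℕ, n₀ ≤ n + 1 → ν.real (Ioi ((n + 1 : ℕ) : ℝ)) ≤ a / (n + 1)) (n : ℕ) :
    tailSum ν (n + 1) ≤ n₀ + 1 + a * harmonic n := by
  induction n with
  | zero =>
    have := tailSum_le ν 1
    simp only [harmonic_zero, zero_add, Nat.cast_one, Rat.cast_zero, mul_zero, add_zero] at this ⊢
    linarith [n₀.cast_nonneg (α := ℝ)]
  | succ n ih =>
    have hle : ν.real (Ioi ((n + 1 : ℕ) : ℝ)) ≤ 1 := measureReal_le_one
    rw [harmonic_succ]
    push_cast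
    by_cases hn : n₀ ≤ n + 1
    · have := h n hn
      rw [tailSum, Finset.sum_range_succ, ← tailSum]
      rw [div_eq_mul_inv] at this
      linarith
    · have h1 := tailSum_le ν (n + 1 + 1)
      have h2 : ((n + 1 + 1 : ℕ) : ℝ) ≤ n₀ := by exact_mod_cast (by omega : n + 1 + 1 ≤ n₀)
      have h3 : (0 : ℝ) ≤ (harmonic n : ℝ) := by
        have : (0 : ℚ) ≤ harmonic n := Finset.sum_nonneg fun i _ => by positivity
        exact_mod_cast this
      have : 0 ≤ a * ((harmonic n : ℝ) + ((n : ℝ) + 1)⁻¹) := by positivity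
      linarith

/-- Choosing `b < l` with `θ * b > 1` makes `tailSum ν n` at least `b * log n` up to a constant, so
the terms are dominated by a convergent `p`-series. -/
theorem summable_exp_tailSum {θ : ℝ≥0} (hθ : 1 / lowerTail ν < θ) :
    Summable fun n => Real.exp (-(θ * tailSum ν n)) := by
  have hθ0 : θ ≠ 0 := by
    rintro rfl
    simp at hθ
  have hθl : (θ : ℝ≥0∞)⁻¹ < lowerTail ν := by
    rwa [one_div, ENNReal.inv_lt_iff_inv_lt] at hθ
  obtain ⟨b, hb1, hb2⟩ := ENNReal.lt_iff_exists_nnreal_btwn.1 hθl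
  have hθb : 1 < (θ : ℝ) * b := by
    rw [← ENNReal.coe_inv hθ0, ENNReal.coe_lt_coe, inv_lt_iff_one_lt_mul₀' (by positivity)] at hb1
    exact_mod_cast hb1
  obtain ⟨s₀, hs₀⟩ := eventually_atTop.1 (eventually_lt_of_lt_liminf hb2)
  obtain ⟨n₀, hn₀⟩ := exists_nat_ge s₀
  have htail : ∀ n : ℕ, n₀ ≤ n + 1 → (b : ℝ) / (n + 1) ≤ ν.real (Ioi ((n + 1 : ℕ) : ℝ)) := by
    intro n hn
    have h1 := (hs₀ ((n + 1 : ℕ) : ℝ) (hn₀.trans (by exact_mod_cast hn))).le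
    have h2 := ENNReal.toReal_mono (by finiteness) h1
    rw [ENNReal.toReal_mul, ENNReal.toReal_ofReal (by positivity), ENNReal.coe_toReal] at h2
    rw [div_le_iff₀ (by positivity), mul_comm]
    push_cast at h2 ⊢
    exact h2
  have hle : ∀ n : ℕ, Real.exp (-(θ * tailSum ν n)) ≤
      Real.exp (θ * (b * n₀ + 1)) * ((n + 1 : ℕ) : ℝ) ^ (-((θ : ℝ) * b)) := by
    intro n
    have hpos : (0 : ℝ) < ((n + 1 : ℕ) : ℝ) := by positivity
    rw [Real.rpow_def_of_pos hpos, ← Real.exp_add, Real.exp_le_exp]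
    have h1 := harmonic_le_tailSum_succ b.coe_nonneg htail n
    have h2 : tailSum ν (n + 1) ≤ tailSum ν n + 1 := by
      rw [tailSum, Finset.sum_range_succ, ← tailSum]
      gcongr
      exact measureReal_le_one
    have h3 := mul_le_mul_of_nonneg_left (log_add_one_le_harmonic n) b.coe_nonneg
    have h4 : (b : ℝ) * Real.log ((n + 1 : ℕ) : ℝ) - b * n₀ - 1 ≤ tailSum ν n := by linarith
    have h5 := mul_le_mul_of_nonneg_left h4 θ.coe_nonneg
    linarith
  refine Summable.of_nonneg_of_le (fun n => (Real.exp_pos _).le) hle (Summable.mul_left _ ?_)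
  exact (summable_nat_add_iff (f := fun n : ℕ => (n : ℝ) ^ (-((θ : ℝ) * b))) 1).2
    (Real.summable_nat_rpow.2 (by linarith))

/-- Eventually the tail at `n` is at most `θ⁻¹ / n`, so `θ * tailSum ν n` is at most `log n` up to a
constant and the terms dominate a multiple of `1 / n`. -/
theorem not_summable_exp_tailSum {θ : ℝ≥0} (hθ : (θ : ℝ≥0∞) < 1 / upperTail ν) :
    ¬ Summable fun n => Real.exp (-(θ * tailSum ν n)) := by
  rcases eq_or_ne θ 0 with rfl | hθ0
  · simp [summable_const_iff]
  have hθu : upperTail ν < ((θ⁻¹ : ℝ≥0) : ℝ≥0∞) := by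
    rw [one_div, ENNReal.lt_inv_iff_lt_inv] at hθ
    rwa [ENNReal.coe_inv hθ0]
  obtain ⟨s₀, hs₀⟩ := eventually_atTop.1 (eventually_lt_of_limsup_lt hθu)
  obtain ⟨n₀, hn₀⟩ := exists_nat_ge s₀
  have hθpos : (0 : ℝ) < θ := by positivity
  have htail : ∀ n : ℕ, n₀ ≤ n + 1 → ν.real (Ioi ((n + 1 : ℕ) : ℝ)) ≤ (θ : ℝ)⁻¹ / (n + 1) := by
    intro n hn
    have h1 := (hs₀ ((n + 1 : ℕ) : ℝ) (hn₀.trans (by exact_mod_cast hn))).le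
    have h2 := ENNReal.toReal_mono (by finiteness) h1
    rw [ENNReal.toReal_mul, ENNReal.toReal_ofReal (by positivity), ENNReal.coe_toReal] at h2
    rw [le_div_iff₀ (by positivity), mul_comm]
    push_cast at h2 ⊢
    exact h2
  intro hs
  have hle : ∀ n : ℕ, ((n + 1 : ℕ) : ℝ) ^ (-1 : ℝ) ≤
      Real.exp (θ * (n₀ + 1) + 1) * Real.exp (-(θ * tailSum ν (n + 1))) := by
    intro n
    have hpos : (0 : ℝ) < ((n + 1 : ℕ) : ℝ) := by positivity
    rw [Real.rpow_def_of_pos hpos, ← Real.exp_add, Real.exp_le_exp]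
    have h1 := tailSum_succ_le_harmonic (inv_nonneg.2 hθpos.le) htail n
    have h2 := harmonic_le_one_add_log n
    have h3 : Real.log (n : ℝ) ≤ Real.log ((n + 1 : ℕ) : ℝ) := by
      rcases n.eq_zero_or_pos with rfl | hn
      · simp
      · exact Real.log_le_log (by exact_mod_cast hn) (by push_cast; linarith)
    have h4 := mul_le_mul_of_nonneg_left h1 hθpos.le
    have h5 : (θ : ℝ) * (n₀ + 1 + (θ : ℝ)⁻¹ * harmonic n) = θ * (n₀ + 1) + harmonic n := by
      field_simp
    linarith
  have h1 : Summable fun n : ℕ => ((n + 1 : ℕ) : ℝ) ^ (-1 : ℝ) :=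
    Summable.of_nonneg_of_le (fun n => by positivity) hle
      (((summable_nat_add_iff (f := fun n => Real.exp (-(θ * tailSum ν n))) 1).2 hs).mul_left _)
  have h2 := (summable_nat_add_iff (f := fun n : ℕ => (n : ℝ) ^ (-1 : ℝ)) 1).1 h1
  rw [Real.summable_nat_rpow] at h2
  exact lt_irrefl _ h2

end Tails

end PoissonBoolean

/-! ### The threshold and the two regimes. -/

theorem mainTheorem5 (ν : Measure ℝ) [IsProbabilityMeasure ν] (hν : ∀ᵐ r ∂ν, 0 < r) :
    (0 < PoissonBoolean.lowerTail ν → PoissonBoolean.upperTail ν < ∞ →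
      ∃ lam₀ : ℝ≥0,
        1 / PoissonBoolean.upperTail ν ≤ (lam₀ : ℝ≥0∞) ∧
        (lam₀ : ℝ≥0∞) ≤ 1 / PoissonBoolean.lowerTail ν ∧
        ∀ (Ω : Type*) [MeasurableSpace Ω] (P : Measure Ω) [IsProbabilityMeasure P]
          (lam : ℝ≥0) (x : ℕ → Ω → (Fin 1 → ℝ)) (ρ : ℕ → Ω → ℝ), 0 < lam →
          PoissonBoolean.IsModel P 1 lam ν x ρ →
            (lam < lam₀ → ∀ᵐ ω ∂P,
              ¬ PoissonBoolean.EventuallyDoublyCovered (fun n => x n ω) (fun n => ρ n ω)) ∧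
            (lam₀ < lam → ∀ᵐ ω ∂P,
              PoissonBoolean.EventuallyDoublyCovered (fun n => x n ω) (fun n => ρ n ω))) ∧
    (∀ (d : ℕ), 2 ≤ d →
      ∀ (Ω : Type*) [MeasurableSpace Ω] (P : Measure Ω) [IsProbabilityMeasure P]
        (lam : ℝ≥0) (x : ℕ → Ω → (Fin d → ℝ)) (ρ : ℕ → Ω → ℝ), 0 < lam →
        PoissonBoolean.IsModel P d lam ν x ρ →
          (PoissonBoolean.upperTail ν = 0 → ∀ᵐ ω ∂P,
            ¬ PoissonBoolean.EventuallyDoublyCovered (fun n => x n ω) (fun n => ρ n ω)) ∧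
          (0 < PoissonBoolean.lowerTail ν → ∀ᵐ ω ∂P,
            PoissonBoolean.EventuallyDoublyCovered (fun n => x n ω) (fun n => ρ n ω))) := by
  refine ⟨fun hl _ => ?_, fun d hd Ω _ P _ lam x ρ hlam h => ⟨fun hL => ?_, fun hl => ?_⟩⟩
  · set S : Set ℝ≥0 :=
      {θ | Summable fun n => Real.exp (-(θ * PoissonBoolean.tailSum ν n))} with hS
    have hl' : 1 / PoissonBoolean.lowerTail ν < ∞ := ENNReal.div_lt_top ENNReal.one_ne_top hl.ne'
    obtain ⟨θ₀, hθ₀, -⟩ := ENNReal.lt_iff_exists_nnreal_btwn.1 hl'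
    have hne : S.Nonempty := ⟨θ₀, PoissonBoolean.summable_exp_tailSum hθ₀⟩
    -- `S` is defined from `ν` alone, so the threshold is the same for every model.
    refine ⟨sInf S, ?_, ?_, fun Ω _ P _ lam x ρ hlam h => ⟨fun hlt => ?_, fun hlt => ?_⟩⟩
    · by_contra! hcon
      obtain ⟨θ, hθ1, hθ2⟩ := ENNReal.lt_iff_exists_nnreal_btwn.1 hcon
      obtain ⟨θ', hθ'S, hθ'⟩ := exists_lt_of_csInf_lt hne (ENNReal.coe_lt_coe.1 hθ1)
      exact PoissonBoolean.not_summable_exp_tailSum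
        ((ENNReal.coe_lt_coe.2 hθ').trans hθ2) hθ'S
    · by_contra! hcon
      obtain ⟨θ, hθ1, hθ2⟩ := ENNReal.lt_iff_exists_nnreal_btwn.1 hcon
      exact notMem_of_lt_csInf (ENNReal.coe_lt_coe.1 hθ2) (OrderBot.bddBelow S)
        (PoissonBoolean.summable_exp_tailSum hθ1)
    · refine h.ae_not_eventuallyDoublyCovered 0 fun T => ?_
      simpa [hS] using notMem_of_lt_csInf hlt (OrderBot.bddBelow S)
    · obtain ⟨θ, hθS, hθ⟩ := exists_lt_of_csInf_lt hne hlt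
      exact h.ae_eventuallyDoublyCovered one_pos θ.coe_nonneg hθS (T := 1) (by simpa using hθ)
  · refine h.ae_not_eventuallyDoublyCovered ⟨0, by omega⟩ fun T => ?_
    have := PoissonBoolean.not_summable_exp_tailSum (ν := ν) (θ := lam * (T : ℝ≥0) ^ (d - 1))
      (by rw [hL, one_div, ENNReal.inv_zero]; exact ENNReal.coe_lt_top)
    simpa using this
  · have hl' : 1 / PoissonBoolean.lowerTail ν < ∞ := ENNReal.div_lt_top ENNReal.one_ne_top hl.ne'
    obtain ⟨θ, hθ, -⟩ := ENNReal.lt_iff_exists_nnreal_btwn.1 hl'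
    have hlam' : (0 : ℝ) < lam := hlam
    obtain ⟨T, hT⟩ := exists_nat_gt ((θ : ℝ) * d / lam)
    have hT0 : T ≠ 0 := by
      rintro rfl
      have : (0 : ℝ) ≤ (θ : ℝ) * d / lam := by positivity
      rw [Nat.cast_zero] at hT
      linarith
    refine h.ae_eventuallyDoublyCovered (by omega) θ.coe_nonneg
      (PoissonBoolean.summable_exp_tailSum hθ) (T := T) ?_
    rw [div_lt_iff₀ hlam'] at hT
    -- Here `d ≥ 2` is essential: widening the strip raises the effective intensity above `θ * d`.
    have hpow : (T : ℝ) ≤ (T : ℝ) ^ (d - 1) :=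
      le_self_pow₀ (by exact_mod_cast Nat.one_le_iff_ne_zero.2 hT0) (by omega)
    nlinarith
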